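/- Let $M=(V,\to,(\mathcal X_v)_{v\in V},(K_v)_{v\in V})$ be a measure-theoretic Bayesian network with a finite vertex set: $(V,\to)$ is a directed acyclic graph, each $\mathcal X_v$ is a measurable space, and each $K_v$ is a probability kernel from $\prod_{u\to v}\mathcal X_u$ to $\mathcal X_v$. Let $\mu$ be the probability measure on $\prod_{v\in V}\mathcal X_v$ that $M$ represents: under $\mu$, for every $v$, the coordinate $X_v$ is conditionally independent of its non-descendants given its parents $X_{\mathrm{pa}(v)}$, and $K_v$ is a version of the conditional distribution of $X_v$ given $X_{\mathrm{pa}(v)}$. Let $E\subseteq V$ be a set of evidence variables, all real-valued, such that for every $i\in E$, every parent assignment $p$ and every Borel set $B\subseteq\mathbb R$ $$K_i(p,B)=\sum_{y\in B}F_i(y\mid p)+\int_B f_i(y\mid p)\,dy ,$$ where $F_i,f_i\ge 0$ are finite and $f_i$ is jointly measurable. Assume that, for every $i\in E$ and every assignment of values to the observed parents of $i$, the set of those $y\in\mathbb R$ for which $F_i(y\mid p)>0$ for at least one parent assignment $p$ extending it is countable. Let $f:\prod_v\mathcal X_v\to\mathbb R$ be measurable with $\mathbb E_\mu|f(X)|<\infty$.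 Given observed values $x_E$, lexicographic likelihood weighting (LLW) produces independent samples $x^{(1)},x^{(2)},\dots$ as follows. For each sample it visits the vertices in a fixed topological order; an evidence variable $i\in E$ is set to its observed value $x_i$, and every other variable $v$ is drawn from $K_v$ given the current values of its parents. Starting from $(d,w)=(0,1)$, at each evidence variable $i$, with current parent values $p$, it updates $$(d,w)\leftarrow\begin{cases}(d,\;w\,F_i(x_i\mid p)) & \text{if }F_i(x_i\mid p)>0,\\ (d+1,\;w\,f_i(x_i\mid p)) & \text{otherwise,}\end{cases}$$ which yields a pair $(d^{(k)},w^{(k)})$ for the $k$-th sample. With $d^*_n=\min\{d^{(k)}: k\le n,\ w^{(k)}\ne 0\}$, its estimate from $n$ samples is $$\hat f_n=\frac{\sum_{k\le n,\ d^{(k)}=d^*_n}w^{(k)}f(x^{(k)})}{\sum_{k\le n,\ d^{(k)}=d^*_n}w^{(k)}} .$$ Then LLW is consistent: for almost every value $x_E$ of the evidence (with respect to the law of $X_E$ under $\mu$), almost surely with respect to the samples, $\hat f_n\to\mathbb E_\mu[f(X)\mid X_E=x_E]$ as $n\to\infty$. -/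

import Mathlib

open MeasureTheory ProbabilityTheory Filter Topology
open scoped NNReal ENNReal

/-- A measure-theoretic Bayesian network with vertex set `V`: a well-founded digraph, a measurable
space for every vertex, and for every vertex a probability kernel from the product of the spaces of
its parents. `edge u v` means that `u` is a parent of `v`. -/
structure MTBN (V : Type*) where
  edge : V → V → Prop
  wf : WellFounded edge
  X : V → Type*
  [mX : ∀ v, MeasurableSpace (X v)]
  K : ∀ v, Kernel (∀ u : {u // edge u v}, X u) (X v)
  [markov : ∀ v, IsMarkovKernel (K v)]

namespace MTBN

attribute [instance] MTBN.mX MTBN.markov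

variable {V : Type*} (M : MTBN V)

/-- The joint space of all the variables. -/
abbrev Joint : Type _ := ∀ v, M.X v

/-- Assignments of values to the parents of `v`. -/
abbrev ParentVal (v : V) : Type _ := ∀ u : {u // M.edge u v}, M.X u

/-- The random variable formed by the parents of `v`. -/
def pa (v : V) (x : M.Joint) : M.ParentVal v := fun u => x u

/-- The random variable formed by the non-descendants of `v` (those vertices `u` to which there is
no directed path from `v`; `v` itself counts as its own descendant). -/
def nd (v : V) (x : M.Joint) : ∀ u : {u // ¬ Relation.ReflTransGen M.edge v u}, M.X u :=
  fun u => x u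

/-- The random variable formed by the vertices in `E`. -/
def obs (E : Finset V) (x : M.Joint) : ∀ u : E, M.X u := fun u => x u

/-- `M` represents the probability measure `μ`: every `X_v` is conditionally independent of its
non-descendants given its parents, and `K v` is a version of the conditional distribution of `X_v`
given its parents. -/
structure Represents (μ : Measure M.Joint) : Prop where
  prob : IsProbabilityMeasure μ
  condIndep : ∀ v, ∀ A : Set (M.X v), MeasurableSet A →
    ∀ B : Set (∀ u : {u // ¬ Relation.ReflTransGen M.edge v u}, M.X u), MeasurableSet B →
      μ⟦(fun x => x v) ⁻¹' A ∩ M.nd v ⁻¹' B | MeasurableSpace.comap (M.pa v) inferInstance⟧ =ᵐ[μ]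
        μ⟦(fun x => x v) ⁻¹' A | MeasurableSpace.comap (M.pa v) inferInstance⟧ *
          μ⟦M.nd v ⁻¹' B | MeasurableSpace.comap (M.pa v) inferInstance⟧
  condDistrib : ∀ v, ∀ A : Set (M.X v), MeasurableSet A →
    (fun x => (M.K v (M.pa v x)).real A) =ᵐ[μ]
      μ⟦(fun x => x v) ⁻¹' A | MeasurableSpace.comap (M.pa v) inferInstance⟧

/-- `L` lists every vertex exactly once, and no vertex comes before one of its parents. -/
structure IsTopologicalOrder (L : List V) : Prop where
  nodup : L.Nodup
  complete : ∀ v, v ∈ L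
  sorted : L.Pairwise (fun a b => ¬ M.edge b a)

/-- The evidence variables are real-valued (`val` identifies their spaces with `ℝ`), and the
conditional law of each of them given its parents is a mixture of a discrete part with masses
`mass v p y` (this is `F_v(y | p)`) and a part with Lebesgue density `dens v p y`
(this is `f_v(y | p)`). -/
structure MixedEvidence (E : Finset V) where
  val : ∀ v : E, M.X v ≃ᵐ ℝ
  mass : ∀ v : E, M.ParentVal v → ℝ → ℝ≥0
  dens : ∀ v : E, M.ParentVal v → ℝ → ℝ≥0
  measurable_dens : ∀ v : E, Measurable (Function.uncurry (dens v))
  mixture : ∀ (v : E) (p : M.ParentVal v) (B : Set ℝ), MeasurableSet B →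
    M.K v p (val v ⁻¹' B) = ∑' y : B, (mass v p y : ℝ≥0∞) + ∫⁻ y in B, (dens v p y : ℝ≥0∞)

lemma measurable_pa (v : V) : Measurable (M.pa v) :=
  measurable_pi_lambda _ fun _ => measurable_pi_apply _

section Sampler

variable [DecidableEq V]

/-- Visiting the vertex `v`: an evidence variable is set to its observed value, any other variable
is drawn from its kernel, given the current values of its parents. -/
noncomputable def visit (E : Finset V) (e : ∀ u : E, M.X u) (v : V) : Kernel M.Joint M.Joint :=
  if h : v ∈ E then
    Kernel.deterministic (fun x : M.Joint => Function.update x v (e ⟨v, h⟩))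
      (measurable_update'.comp (measurable_id.prodMk measurable_const))
  else
    (Kernel.id ×ₖ (M.K v).comap (M.pa v) (M.measurable_pa v)).map
      (fun q : M.Joint × M.X v => Function.update q.1 v q.2)

instance (E : Finset V) (e : ∀ u : E, M.X u) (v : V) : IsMarkovKernel (M.visit E e v) := by
  unfold visit
  split_ifs
  · infer_instance
  · exact Kernel.IsMarkovKernel.map _ measurable_update'

/-- The law of one sample: starting from arbitrary contents `x₀` (every coordinate of which is
overwritten), visit the vertices in the order in which they are listed. -/
noncomputable def sampleLaw (L : List V) (E : Finset V) (e : ∀ u : E, M.X u) (x₀ : M.Joint) :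
    Measure M.Joint :=
  L.foldl (fun ν v => ν.bind (M.visit E e v)) (Measure.dirac x₀)

instance (L : List V) (E : Finset V) (e : ∀ u : E, M.X u) (x₀ : M.Joint) :
    IsProbabilityMeasure (M.sampleLaw L E e x₀) := by
  unfold sampleLaw
  suffices h : ∀ ν : Measure M.Joint, IsProbabilityMeasure ν →
      IsProbabilityMeasure (L.foldl (fun ν v => ν.bind (M.visit E e v)) ν) from h _ inferInstance
  induction L with
  | nil => exact fun ν hν => hν
  | cons v L ih => exact fun ν hν => ih _ inferInstance

variable {M}

/-- The pair (number of densities, weight) of a sample `x`, updated at the evidence variables in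
the order of the visits, from `(0, 1)`. -/
noncomputable def MixedEvidence.score {E : Finset V} (ev : M.MixedEvidence E) (L : List V)
    (x : M.Joint) : ℕ × ℝ≥0 :=
  L.foldl
    (fun dw v =>
      if h : v ∈ E then
        if 0 < ev.mass ⟨v, h⟩ (M.pa v x) (ev.val ⟨v, h⟩ (x v)) then
          (dw.1, dw.2 * ev.mass ⟨v, h⟩ (M.pa v x) (ev.val ⟨v, h⟩ (x v)))
        else
          (dw.1 + 1, dw.2 * ev.dens ⟨v, h⟩ (M.pa v x) (ev.val ⟨v, h⟩ (x v)))
      else dw)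
    (0, 1)

/-- The least number of densities among those of the first `n` samples that have nonzero weight. -/
noncomputable def MixedEvidence.minDensities {E : Finset V} (ev : M.MixedEvidence E) (L : List V)
    (n : ℕ) (s : ℕ → M.Joint) : ℕ :=
  sInf {d | ∃ k < n, (ev.score L (s k)).2 ≠ 0 ∧ (ev.score L (s k)).1 = d}

/-- The output of lexicographic likelihood weighting on the first `n` samples of `s`. -/
noncomputable def MixedEvidence.estimate {E : Finset V} (ev : M.MixedEvidence E) (L : List V)
    (g : M.Joint → ℝ) (n : ℕ) (s : ℕ → M.Joint) : ℝ :=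
  (∑ k ∈ Finset.range n with (ev.score L (s k)).1 = ev.minDensities L n s,
      ((ev.score L (s k)).2 : ℝ) * g (s k)) /
    ∑ k ∈ Finset.range n with (ev.score L (s k)).1 = ev.minDensities L n s,
      ((ev.score L (s k)).2 : ℝ)

end Sampler

end MTBN

/-
The number of densities and the weight of a sample depend on whether each observed value is an atom
given the sampled parents, which varies from sample to sample. What matters is whether the value is
an atom on average over the sampler run up to that vertex: if it is, only the samples for which it
is an atom keep the least number of densities, and they are weighted by its mass; if it is not, it
is almost surely no atom at all, and every sample is weighted by its density. Restricted to the
least number of densities, the weight is therefore the likelihood of the evidence with respect to a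
fixed reference measure, counting measure on the average atoms plus Lebesgue measure; countability
of the possible atoms makes the latter blind to the former. Going through the vertices in order,
one finds that the weighted sampler disintegrates the law of the network along the evidence, so that
the conditional expectation of `g` is its weighted mean over the fibre. The strong law of large
numbers for the numerator and the denominator of the estimate gives the same limit, since almost
surely some sample attains the least number of densities with a nonzero weight.
-/

section Disintegration

variable {Ω 𝓔 G : Type*} [MeasurableSpace Ω] [MeasurableSpace 𝓔] [NormedAddCommGroup G]
  [NormedSpace ℝ G] {η : Kernel 𝓔 Ω} {ρ : Measure 𝓔} {o : Ω → 𝓔} {g : Ω → G}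

theorem map_comp_eq_withDensity (hom : Measurable o) (ho : ∀ᵐ e ∂ρ, ∀ᵐ x ∂(η e), o x = e) :
    (η ∘ₘ ρ).map o = ρ.withDensity fun e => η e Set.univ := by
  ext s hs
  rw [Measure.map_apply hom hs, Measure.bind_apply (hom hs) η.aemeasurable,
    withDensity_apply _ hs, ← lintegral_indicator hs]
  refine lintegral_congr_ae (ho.mono fun e he => ?_)
  by_cases hes : e ∈ s
  · rw [Set.indicator_of_mem hes]
    exact measure_congr (eventuallyEq_univ.2 (he.mono fun x hx => (hx ▸ hes : o x ∈ s)))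
  · rw [Set.indicator_of_notMem hes]
    exact measure_eq_zero_iff_ae_notMem.2 (he.mono fun x hx hxs => hes (hx ▸ hxs))

theorem ae_comp_of_ae_of_ne_zero (hom : Measurable o) (ho : ∀ᵐ e ∂ρ, ∀ᵐ x ∂(η e), o x = e)
    {p : 𝓔 → Prop} (h : ∀ᵐ e ∂ρ, η e Set.univ ≠ 0 → p e) : ∀ᵐ x ∂(η ∘ₘ ρ), p (o x) := by
  refine ae_of_ae_map hom.aemeasurable ?_
  rwa [map_comp_eq_withDensity hom ho, ae_withDensity_iff (η.measurable_coe .univ)]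

theorem ae_measure_univ_lt_top [IsFiniteMeasure (η ∘ₘ ρ)] : ∀ᵐ e ∂ρ, η e Set.univ < ∞ := by
  refine ae_lt_top (η.measurable_coe .univ) ?_
  rw [← Measure.bind_apply .univ η.aemeasurable]
  exact measure_ne_top _ _

theorem integrable_integral_of_comp (hg : Integrable g (η ∘ₘ ρ)) :
    Integrable (fun e => ∫ x, g x ∂(η e)) ρ := by
  rw [Measure.comp_eq_comp_const_apply] at hg
  simpa using hg.integral_comp

theorem integral_comp_measure (hg : Integrable g (η ∘ₘ ρ)) :
    ∫ x, g x ∂(η ∘ₘ ρ) = ∫ e, ∫ x, g x ∂(η e) ∂ρ := by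
  rw [Measure.comp_eq_comp_const_apply] at hg ⊢
  simpa using Kernel.integral_comp hg

theorem setIntegral_preimage_comp (hom : Measurable o) (ho : ∀ᵐ e ∂ρ, ∀ᵐ x ∂(η e), o x = e)
    (hg : Integrable g (η ∘ₘ ρ)) {s : Set 𝓔} (hs : MeasurableSet s) :
    ∫ x in o ⁻¹' s, g x ∂(η ∘ₘ ρ) = ∫ e in s, ∫ x, g x ∂(η e) ∂ρ := by
  rw [← integral_indicator (hom hs), integral_comp_measure (hg.indicator (hom hs)),
    ← integral_indicator hs]
  refine integral_congr_ae (ho.mono fun e he => ?_)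
  have hind : (o ⁻¹' s).indicator g =ᵐ[η e] fun x => s.indicator (fun _ => g x) e :=
    he.mono fun x hx => by classical simp [Set.indicator_apply, hx]
  dsimp only
  rw [integral_congr_ae hind]
  by_cases hes : e ∈ s <;> simp [hes]

variable [IsFiniteMeasure (η ∘ₘ ρ)]

theorem toReal_measure_univ_smul_average :
    (fun e => (η e Set.univ).toReal • ⨍ y, g y ∂(η e)) =ᵐ[ρ] fun e => ∫ y, g y ∂(η e) := by
  filter_upwards [ae_measure_univ_lt_top (η := η) (ρ := ρ)] with e he
  have : IsFiniteMeasure (η e) := ⟨he⟩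
  exact measure_smul_average (η e) g

theorem integrable_average_comp (hom : Measurable o) (ho : ∀ᵐ e ∂ρ, ∀ᵐ x ∂(η e), o x = e)
    (hg : Integrable g (η ∘ₘ ρ)) :
    Integrable (fun e => ⨍ y, g y ∂(η e)) ((η ∘ₘ ρ).map o) := by
  rw [map_comp_eq_withDensity hom ho, integrable_withDensity_iff_integrable_smul'
    (η.measurable_coe .univ) ae_measure_univ_lt_top]
  exact (integrable_integral_of_comp hg).congr toReal_measure_univ_smul_average.symm

theorem condExp_comap_ae_eq_average [CompleteSpace G] (hom : Measurable o)
    (ho : ∀ᵐ e ∂ρ, ∀ᵐ x ∂(η e), o x = e) (hg : Integrable g (η ∘ₘ ρ)) :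
    (η ∘ₘ ρ)[g | MeasurableSpace.comap o inferInstance] =ᵐ[η ∘ₘ ρ]
      fun x => ⨍ y, g y ∂(η (o x)) := by
  have hav := integrable_average_comp hom ho hg
  refine (ae_eq_condExp_of_forall_setIntegral_eq hom.comap_le hg
    (fun _ _ _ => (hav.comp_measurable hom).integrableOn) ?_
    (hav.aestronglyMeasurable.comp_ae_measurable' hom.aemeasurable)).symm
  rintro _ ⟨s, hs, rfl⟩ -
  calc ∫ x in o ⁻¹' s, ⨍ y, g y ∂(η (o x)) ∂(η ∘ₘ ρ)
      = ∫ e in s, ⨍ y, g y ∂(η e) ∂(ρ.withDensity fun e => η e Set.univ) := by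
        rw [← map_comp_eq_withDensity hom ho,
          setIntegral_map hs hav.aestronglyMeasurable hom.aemeasurable]
    _ = ∫ e in s, (η e Set.univ).toReal • ⨍ y, g y ∂(η e) ∂ρ :=
        setIntegral_withDensity_eq_setIntegral_toReal_smul (η.measurable_coe .univ)
          (ae_restrict_of_ae ae_measure_univ_lt_top) _ hs
    _ = ∫ e in s, ∫ y, g y ∂(η e) ∂ρ :=
        integral_congr_ae (ae_restrict_of_ae toReal_measure_univ_smul_average)
    _ = ∫ x in o ⁻¹' s, g x ∂(η ∘ₘ ρ) := (setIntegral_preimage_comp hom ho hg hs).symm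

end Disintegration

section LawOfLargeNumbers

variable {Ω G : Type*} [MeasurableSpace Ω] {ν : Measure Ω} [IsProbabilityMeasure ν]

theorem ae_tendsto_average_infinitePi [NormedAddCommGroup G] [NormedSpace ℝ G] [CompleteSpace G]
    [MeasurableSpace G] [BorelSpace G] {φ : Ω → G} (hφ : Measurable φ) (hφi : Integrable φ ν) :
    ∀ᵐ s ∂(Measure.infinitePi fun _ : ℕ => ν),
      Tendsto (fun n : ℕ => (n : ℝ)⁻¹ • ∑ i ∈ Finset.range n, φ (s i)) atTop
        (𝓝 (∫ x, φ x ∂ν)) := by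
  have hmp := measurePreserving_eval_infinitePi fun _ : ℕ => ν
  have hind : iIndepFun (fun (i : ℕ) (s : ℕ → Ω) => φ (s i)) (Measure.infinitePi fun _ => ν) :=
    iIndepFun_infinitePi (X := fun _ => φ) fun _ => hφ
  have hident (i j : ℕ) : IdentDistrib (fun s : ℕ → Ω => φ (s i)) (fun s => φ (s j))
      (Measure.infinitePi fun _ => ν) (Measure.infinitePi fun _ => ν) :=
    IdentDistrib.comp ⟨(hmp i).aemeasurable, (hmp j).aemeasurable,
      (hmp i).map_eq.trans (hmp j).map_eq.symm⟩ hφ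
  have hintegral : ∫ s, φ (s 0) ∂(Measure.infinitePi fun _ : ℕ => ν) = ∫ x, φ x ∂ν := by
    rw [← integral_map (hmp 0).aemeasurable (by
      rw [(hmp 0).map_eq]; exact hφi.aestronglyMeasurable), (hmp 0).map_eq]
  rw [← hintegral]
  exact strong_law_ae (fun (i : ℕ) (s : ℕ → Ω) => φ (s i))
    ((hmp 0).integrable_comp_of_integrable hφi) (fun i j hij => hind.indepFun hij)
    fun i => hident i 0

theorem ae_tendsto_selfNormalized_average {w : Ω → ℝ≥0} (hw : Measurable w)
    (hwtop : ν.withDensity (fun x => w x) Set.univ ≠ ∞)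
    (hw0 : ν.withDensity (fun x => w x) Set.univ ≠ 0) {g : Ω → ℝ} (hg : Measurable g)
    (hgi : Integrable g (ν.withDensity fun x => w x)) :
    ∀ᵐ s ∂(Measure.infinitePi fun _ : ℕ => ν),
      Tendsto (fun n => (∑ k ∈ Finset.range n, (w (s k) : ℝ) * g (s k)) /
        ∑ k ∈ Finset.range n, (w (s k) : ℝ)) atTop
        (𝓝 (⨍ x, g x ∂(ν.withDensity fun x => w x))) := by
  have : IsFiniteMeasure (ν.withDensity fun x => w x) := ⟨hwtop.lt_top⟩
  have hintegral (f : Ω → ℝ) : ∫ x, f x ∂(ν.withDensity fun x => w x) = ∫ x, w x * f x ∂ν :=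
    integral_withDensity_eq_integral_smul hw f
  have hintegrable {f : Ω → ℝ} (hf : Integrable f (ν.withDensity fun x => w x)) :
      Integrable (fun x => w x * f x) ν := (integrable_withDensity_iff_integrable_smul hw).1 hf
  have hmass : (ν.withDensity fun x => w x).real Set.univ = ∫ x, (w x : ℝ) ∂ν := by
    simpa using hintegral fun _ => 1
  have hmass0 : ∫ x, (w x : ℝ) ∂ν ≠ 0 := by
    rw [← hmass, measureReal_ne_zero_iff]; exact hw0
  have hwi : Integrable (fun x => (w x : ℝ)) ν := by
    simpa using hintegrable (integrable_const 1)
  filter_upwards [ae_tendsto_average_infinitePi (by fun_prop) (hintegrable hgi),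
    ae_tendsto_average_infinitePi (by fun_prop) hwi] with s hnum hden
  rw [average_eq, hintegral, hmass, smul_eq_mul, inv_mul_eq_div]
  refine (hnum.div hden hmass0).congr' ?_
  filter_upwards [eventually_gt_atTop 0] with n hn
  exact mul_div_mul_left _ _ (by positivity)

theorem ae_exists_mem_infinitePi {A : Set Ω} (hA : MeasurableSet A) (hA0 : ν A ≠ 0) :
    ∀ᵐ s ∂(Measure.infinitePi fun _ : ℕ => ν), ∃ k, s k ∈ A := by
  filter_upwards [ae_tendsto_average_infinitePi (measurable_const.indicator hA)
    ((integrable_const (1 : ℝ)).indicator hA)] with s hs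
  by_contra! h
  simp only [Set.indicator_of_notMem (h _), Finset.sum_const_zero,
    integral_indicator_const _ hA, smul_eq_mul, mul_one, mul_zero] at hs
  exact (measureReal_ne_zero_iff (measure_ne_top ν A)).2 hA0
    (tendsto_nhds_unique hs tendsto_const_nhds)

end LawOfLargeNumbers

theorem measureReal_inter_eq_setIntegral_condExp {Ω : Type*} {m mΩ : MeasurableSpace Ω}
    {μ : Measure Ω} [IsFiniteMeasure μ] (hm : m ≤ mΩ) {S T : Set Ω} (hS : MeasurableSet S)
    (hT : MeasurableSet T) (h : μ⟦S ∩ T | m⟧ =ᵐ[μ] μ⟦S | m⟧ * μ⟦T | m⟧) :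
    μ.real (S ∩ T) = ∫ x in T, (μ⟦S | m⟧) x ∂μ := by
  have hTi : Integrable (T.indicator fun _ => (1 : ℝ)) μ := (integrable_const 1).indicator hT
  have hmul : μ⟦S | m⟧ * (T.indicator fun _ => 1) = T.indicator (μ⟦S | m⟧) := by
    ext x
    by_cases hx : x ∈ T <;> simp [hx]
  have hpull : μ⟦S ∩ T | m⟧ =ᵐ[μ] μ[T.indicator (μ⟦S | m⟧) | m] := by
    refine h.trans ?_
    rw [← hmul]
    exact (condExp_mul_of_stronglyMeasurable_left stronglyMeasurable_condExp
      (hmul ▸ integrable_condExp.indicator hT) hTi).symm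
  calc μ.real (S ∩ T)
      = ∫ x, (S ∩ T).indicator (fun _ => (1 : ℝ)) x ∂μ := by
        rw [integral_indicator_const _ (hS.inter hT), smul_eq_mul, mul_one]
    _ = ∫ x, (μ⟦S ∩ T | m⟧) x ∂μ := (integral_condExp hm).symm
    _ = ∫ x, (μ[T.indicator (μ⟦S | m⟧) | m]) x ∂μ := integral_congr_ae hpull
    _ = ∫ x, T.indicator (μ⟦S | m⟧) x ∂μ := integral_condExp hm
    _ = ∫ x in T, (μ⟦S | m⟧) x ∂μ := integral_indicator hT

section Mixture

variable {Ω 𝓨 𝓔 : Type*} [MeasurableSpace Ω] [MeasurableSpace 𝓨] [MeasurableSpace 𝓔]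

/-- The conditional laws `k ω` are mixtures of a discrete part with masses `F ω` and a part with
density `f ω` with respect to `m`. -/
structure IsMixture (k : Kernel Ω 𝓨) (m : Measure 𝓨) (F f : Ω → 𝓨 → ℝ≥0) : Prop where
  measurable_mass : Measurable (Function.uncurry F)
  measurable_dens : Measurable (Function.uncurry f)
  apply_eq : ∀ ω, k ω =
    Measure.sum (fun y => (F ω y : ℝ≥0∞) • Measure.dirac y) + m.withDensity fun y => f ω y

/-- The mass at `y` of the average of the discrete measures with masses `F ω`, with `ω` drawn
from `P`. -/
noncomputable def meanMass (P : Measure Ω) (F : Ω → 𝓨 → ℝ≥0) (y : 𝓨) : ℝ≥0∞ :=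
  ∫⁻ ω, F ω y ∂P

/-- The likelihood of `ω` given an observation `y` from a mixture: the mass at `y` if `y` is an atom
of the average law under `P`, and the density at `y` otherwise. -/
noncomputable def mixedLikelihood (P : Measure Ω) (F f : Ω → 𝓨 → ℝ≥0) (ω : Ω) (y : 𝓨) : ℝ≥0 :=
  open Classical in if meanMass P F y = 0 then f ω y else F ω y

/-- The measure, given `e`, with respect to which `mixedLikelihood` is a likelihood: the counting
measure on the atoms of the average law under `κ e`, plus `m`. The counting measure is written as
the average law divided by its masses, because in this form it depends measurably on `e`. -/
noncomputable def refKernel (κ : Kernel 𝓔 Ω) [IsSFiniteKernel κ] (k : Kernel Ω 𝓨)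
    [IsSFiniteKernel k] (m : Measure 𝓨) (F : Ω → 𝓨 → ℝ≥0) : Kernel 𝓔 𝓨 :=
  (k ∘ₖ κ).withDensity
    (fun e y => open Classical in if meanMass (κ e) F y = 0 then 0 else (meanMass (κ e) F y)⁻¹) +
  Kernel.const 𝓔 m

instance (κ : Kernel 𝓔 Ω) [IsSFiniteKernel κ] (k : Kernel Ω 𝓨) [IsSFiniteKernel k]
    (m : Measure 𝓨) [SFinite m] (F : Ω → 𝓨 → ℝ≥0) : IsSFiniteKernel (refKernel κ k m F) := by
  have := Kernel.IsSFiniteKernel.withDensity (f := fun e y => open Classical in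
    if meanMass (κ e) F y = 0 then 0 else (meanMass (κ e) F y)⁻¹) (k ∘ₖ κ)
    fun e y => by split_ifs with h <;> simp [h]
  unfold refKernel
  infer_instance

theorem lintegral_tsum_of_countable {ι : Type*} {P : Measure Ω} {φ : ι → Ω → ℝ≥0∞}
    (hφ : ∀ i, Measurable (φ i)) {C : Set ι} (hC : C.Countable)
    (h0 : ∀ᵐ ω ∂P, ∀ i ∉ C, φ i ω = 0) : ∫⁻ ω, ∑' i, φ i ω ∂P = ∑' i, ∫⁻ ω, φ i ω ∂P := by
  have : Countable C := hC
  calc ∫⁻ ω, ∑' i, φ i ω ∂P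
      = ∫⁻ ω, ∑' i : C, φ i ω ∂P := by
        refine lintegral_congr_ae (h0.mono fun ω hω => ?_)
        exact (tsum_subtype_eq_of_support_subset (f := fun i => φ i ω)
          (Function.support_subset_iff'.2 hω)).symm
    _ = ∑' i : C, ∫⁻ ω, φ i ω ∂P := lintegral_tsum fun i => (hφ i).aemeasurable
    _ = ∑' i, ∫⁻ ω, φ i ω ∂P := by
        refine tsum_subtype_eq_of_support_subset (f := fun i => ∫⁻ ω, φ i ω ∂P)
          (Function.support_subset_iff'.2 fun i hi => ?_)
        exact (lintegral_congr_ae (h0.mono fun ω hω => hω i hi)).trans lintegral_zero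

namespace IsMixture

variable {k : Kernel Ω 𝓨} {m : Measure 𝓨} {F f : Ω → 𝓨 → ℝ≥0} {P : Measure Ω}

section Measurability

variable {κ : Kernel 𝓔 Ω} [IsSFiniteKernel κ]

theorem measurable_meanMass (h : IsMixture k m F f) :
    Measurable fun q : 𝓔 × 𝓨 => meanMass (κ q.1) F q.2 := by
  have hF : Measurable fun q : (𝓔 × 𝓨) × Ω => (F q.2 q.1.2 : ℝ≥0∞) :=
    (h.measurable_mass.comp (measurable_snd.prodMk
      (measurable_snd.comp measurable_fst))).coe_nnreal_ennreal
  exact hF.lintegral_kernel_prod_right' (κ := κ.prodMkRight 𝓨)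

theorem measurableSet_meanMass_eq_zero (h : IsMixture k m F f) :
    MeasurableSet {q : 𝓔 × 𝓨 | meanMass (κ q.1) F q.2 = 0} :=
  h.measurable_meanMass (measurableSet_singleton 0)

theorem measurable_mixedLikelihood (h : IsMixture k m F f) :
    Measurable fun q : (𝓔 × 𝓨) × Ω => mixedLikelihood (κ q.1.1) F f q.2 q.1.2 :=
  have hsnd : Measurable fun q : (𝓔 × 𝓨) × Ω => (q.2, q.1.2) := by fun_prop
  Measurable.ite (measurable_fst h.measurableSet_meanMass_eq_zero)
    (h.measurable_dens.comp hsnd) (h.measurable_mass.comp hsnd)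

theorem refKernel_apply [IsSFiniteKernel k] (h : IsMixture k m F f) (e : 𝓔) :
    refKernel κ k m F e = (k ∘ₘ κ e).withDensity
      (fun y => open Classical in
        if meanMass (κ e) F y = 0 then 0 else (meanMass (κ e) F y)⁻¹) + m := by
  have hr : Measurable (Function.uncurry fun e y => open Classical in
      if meanMass (κ e) F y = 0 then 0 else (meanMass (κ e) F y)⁻¹) :=
    Measurable.ite h.measurableSet_meanMass_eq_zero measurable_const h.measurable_meanMass.inv
  rw [refKernel, add_apply, Kernel.withDensity_apply _ hr, Kernel.comp_apply, Kernel.const_apply]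

end Measurability

theorem measurable_mass_left (h : IsMixture k m F f) (y : 𝓨) :
    Measurable fun ω => (F ω y : ℝ≥0∞) :=
  (h.measurable_mass.comp measurable_prodMk_right).coe_nnreal_ennreal

theorem lintegral_eq (h : IsMixture k m F f) (ω : Ω) {H : 𝓨 → ℝ≥0∞} (hH : Measurable H) :
    ∫⁻ y, H y ∂(k ω) = ∑' y, F ω y * H y + ∫⁻ y, f ω y * H y ∂m := by
  have hf : Measurable fun y => (f ω y : ℝ≥0∞) :=
    (h.measurable_dens.comp measurable_prodMk_left).coe_nnreal_ennreal
  rw [h.apply_eq, lintegral_add_measure, lintegral_sum_measure,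
    lintegral_withDensity_eq_lintegral_mul _ hf hH]
  simp only [lintegral_smul_measure, lintegral_dirac' _ hH, smul_eq_mul, Pi.mul_apply]

theorem mass_le (h : IsMixture k m F f) (ω : Ω) (y : 𝓨) : F ω y ≤ k ω Set.univ := by
  have hone := h.lintegral_eq ω (H := fun _ => 1) measurable_const
  simp only [lintegral_one, mul_one] at hone
  exact hone ▸ (ENNReal.le_tsum y).trans le_self_add

theorem meanMass_ne_top [IsFiniteKernel k] [IsFiniteMeasure P] (h : IsMixture k m F f) (y : 𝓨) :
    meanMass P F y ≠ ∞ := by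
  refine ne_top_of_le_ne_top (measure_ne_top (k ∘ₘ P) Set.univ) ?_
  rw [Measure.bind_apply .univ k.aemeasurable]
  exact lintegral_mono fun ω => h.mass_le ω y

theorem ae_mass_eq_zero (h : IsMixture k m F f) {y : 𝓨} (hy : meanMass P F y = 0) :
    ∀ᵐ ω ∂P, F ω y = 0 := by
  filter_upwards [(lintegral_eq_zero_iff (h.measurable_mass_left y)).1 hy] with ω hω
  simpa using hω

theorem ae_meanMass_eq_zero [NullSingletonClass m] {C : Set 𝓨} (hC : C.Countable)
    (hF : ∀ᵐ ω ∂P, ∀ y ∉ C, F ω y = 0) :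
    ∀ᵐ y ∂m, meanMass P F y = 0 := by
  filter_upwards [hC.ae_notMem m] with y hy
  refine (lintegral_congr_ae (hF.mono fun ω hω => ?_)).trans lintegral_zero
  simp [hω y hy]

variable [SFinite m]

theorem lintegral_lintegral_eq [SFinite P] (h : IsMixture k m F f) {C : Set 𝓨} (hC : C.Countable)
    (hF : ∀ᵐ ω ∂P, ∀ y ∉ C, F ω y = 0) {H : Ω → 𝓨 → ℝ≥0∞}
    (hH : Measurable (Function.uncurry H)) :
    ∫⁻ ω, ∫⁻ y, H ω y ∂(k ω) ∂P =
      ∑' y, ∫⁻ ω, F ω y * H ω y ∂P + ∫⁻ y, ∫⁻ ω, f ω y * H ω y ∂P ∂m := by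
  have hFH (y : 𝓨) : Measurable fun ω => F ω y * H ω y :=
    (h.measurable_mass_left y).mul (hH.comp measurable_prodMk_right)
  have hfH : Measurable (Function.uncurry fun ω y => (f ω y : ℝ≥0∞) * H ω y) :=
    h.measurable_dens.coe_nnreal_ennreal.mul hH
  have hlin (ω : Ω) := h.lintegral_eq ω (H := H ω) (hH.comp measurable_prodMk_left)
  simp_rw [hlin]
  rw [lintegral_add_right _ (Measurable.lintegral_prod_right hfH),
    lintegral_tsum_of_countable hFH hC (hF.mono fun ω hω y hy => by simp [hω y hy]),
    lintegral_lintegral_swap hfH.aemeasurable]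

variable [NullSingletonClass m] [IsFiniteKernel k] {κ : Kernel 𝓔 Ω} [IsFiniteKernel κ]

theorem lintegral_refKernel (h : IsMixture k m F f) (e : 𝓔) {C : Set 𝓨} (hC : C.Countable)
    (hF : ∀ᵐ ω ∂(κ e), ∀ y ∉ C, F ω y = 0) {Q : 𝓨 → ℝ≥0∞} (hQ : Measurable Q) :
    ∫⁻ y, Q y ∂(refKernel κ k m F e) =
      ∑' y, {y | meanMass (κ e) F y ≠ 0}.indicator Q y + ∫⁻ y, Q y ∂m := by
  classical
  set a := meanMass (κ e) F with ha
  have ham : Measurable a := h.measurable_mass.coe_nnreal_ennreal.lintegral_prod_left'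
  set r : 𝓨 → ℝ≥0∞ := fun y => if a y = 0 then 0 else (a y)⁻¹ with hr
  have hrm : Measurable r :=
    Measurable.ite (ham (measurableSet_singleton 0)) measurable_const ham.inv
  have hrQ : Measurable fun y => r y * Q y := hrm.mul hQ
  have hdens : ∫⁻ y, ∫⁻ ω, f ω y * (r y * Q y) ∂(κ e) ∂m = 0 := by
    refine (lintegral_congr_ae ?_).trans lintegral_zero
    filter_upwards [ae_meanMass_eq_zero (m := m) hC hF] with y hy
    simp [hr, ha, hy]
  have hmass (y : 𝓨) :
      ∫⁻ ω, F ω y * (r y * Q y) ∂(κ e) = {y | a y ≠ 0}.indicator Q y := by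
    rw [lintegral_mul_const _ (h.measurable_mass_left y), ← meanMass, ← ha]
    by_cases hy : a y = 0
    · simp [hy]
    · simp [hr, hy, ← mul_assoc, ENNReal.mul_inv_cancel hy (h.meanMass_ne_top y)]
  rw [h.refKernel_apply, lintegral_add_measure, lintegral_withDensity_eq_lintegral_mul _ hrm hQ,
    Measure.lintegral_bind k.aemeasurable (hrm.mul hQ).aemeasurable]
  simp only [Pi.mul_apply]
  rw [h.lintegral_lintegral_eq hC hF (H := fun _ y => r y * Q y) (hrQ.comp measurable_snd), hdens,
    add_zero, tsum_congr hmass]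

theorem lintegral_lintegral_eq_refKernel (h : IsMixture k m F f) (e : 𝓔) {C : Set 𝓨}
    (hC : C.Countable) (hF : ∀ᵐ ω ∂(κ e), ∀ y ∉ C, F ω y = 0) {H : Ω → 𝓨 → ℝ≥0∞}
    (hH : Measurable (Function.uncurry H)) :
    ∫⁻ ω, ∫⁻ y, H ω y ∂(k ω) ∂(κ e) =
      ∫⁻ y, ∫⁻ ω, mixedLikelihood (κ e) F f ω y * H ω y ∂(κ e) ∂(refKernel κ k m F e) := by
  have hlik : Measurable fun q : 𝓨 × Ω => mixedLikelihood (κ e) F f q.2 q.1 :=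
    (h.measurable_mixedLikelihood (κ := κ)).comp
      (by fun_prop : Measurable fun q : 𝓨 × Ω => ((e, q.1), q.2))
  have hQ : Measurable fun y => ∫⁻ ω, mixedLikelihood (κ e) F f ω y * H ω y ∂(κ e) :=
    (hlik.coe_nnreal_ennreal.mul (hH.comp measurable_swap)).lintegral_prod_right'
  rw [h.lintegral_lintegral_eq hC hF hH, h.lintegral_refKernel e hC hF hQ]
  congr 1
  · refine tsum_congr fun y => ?_
    by_cases hy : meanMass (κ e) F y = 0
    · rw [Set.indicator_of_notMem (by simpa using hy)]
      refine (lintegral_congr_ae ?_).trans lintegral_zero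
      filter_upwards [h.ae_mass_eq_zero hy] with ω hω
      simp [hω]
    · rw [Set.indicator_of_mem hy]
      simp only [mixedLikelihood, if_neg hy]
  · refine lintegral_congr_ae ?_
    filter_upwards [ae_meanMass_eq_zero (m := m) hC hF] with y hy
    simp only [mixedLikelihood, if_pos hy]

end IsMixture

end Mixture

section LexicographicWeight

/-- The update of a pair (number of densities, weight) by an observation with mass `F` and
density `f`. -/
noncomputable def lexUpdate (s : ℕ × ℝ≥0) (F f : ℝ≥0) : ℕ × ℝ≥0 :=
  if 0 < F then (s.1, s.2 * F) else (s.1 + 1, s.2 * f)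

/-- The weight of a score, counted only if its number of densities is `N`. -/
def weightAt (N : ℕ) (s : ℕ × ℝ≥0) : ℝ≥0 := if s.1 = N then s.2 else 0

theorem measurable_lexUpdate :
    Measurable fun q : (ℕ × ℝ≥0) × ℝ≥0 × ℝ≥0 => lexUpdate q.1 q.2.1 q.2.2 :=
  Measurable.ite (measurableSet_lt measurable_const (by fun_prop)) (by fun_prop) (by fun_prop)

theorem measurable_weightAt : Measurable (Function.uncurry weightAt) :=
  Measurable.ite (measurableSet_eq_fun (by fun_prop) (by fun_prop)) (by fun_prop) (by fun_prop)

variable {N : ℕ} {s : ℕ × ℝ≥0} {F : ℝ≥0} {a : Prop} [Decidable a]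

theorem le_fst_lexUpdate (hN : N ≤ s.1) (ha : a → F = 0) (f : ℝ≥0) :
    (if a then N + 1 else N) ≤ (lexUpdate s F f).1 := by
  unfold lexUpdate
  split_ifs with h hF hF
  · exact absurd (ha h) hF.ne'
  · exact Nat.succ_le_succ hN
  · exact hN
  · exact hN.trans (Nat.le_succ _)

theorem weightAt_lexUpdate (hN : N ≤ s.1) (ha : a → F = 0) (f : ℝ≥0) :
    weightAt (if a then N + 1 else N) (lexUpdate s F f) =
      (if a then f else F) * weightAt N s := by
  by_cases h : a
  · simp [h, ha h, weightAt, lexUpdate, mul_comm]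
  obtain rfl | hF := eq_or_lt_of_le (zero_le (a := F))
  · have : s.1 + 1 ≠ N := by omega
    simp [h, weightAt, lexUpdate, this]
  · simp [h, hF, weightAt, lexUpdate, mul_comm]

end LexicographicWeight

namespace MTBN

section Order

variable {V : Type*} (M : MTBN V)

/-- `L` lists an ancestral set of vertices without repetition, parents first. These are the initial
segments of the topological orders. -/
structure IsAncestralOrder (L : List V) : Prop where
  nodup : L.Nodup
  sorted : L.Pairwise (fun a b => ¬ M.edge b a)
  closed : ∀ v ∈ L, ∀ u, M.edge u v → u ∈ L

variable {M}

theorem IsTopologicalOrder.isAncestralOrder {L : List V} (h : M.IsTopologicalOrder L) :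
    M.IsAncestralOrder L :=
  ⟨h.nodup, h.sorted, fun _ _ _ _ => h.complete _⟩

theorem edge_irrefl (v : V) : ¬ M.edge v v := fun h => M.wf.asymmetric _ _ h h

namespace IsAncestralOrder

variable {L : List V} {u v : V}

theorem notMem (h : M.IsAncestralOrder (L ++ [v])) : v ∉ L := fun hv =>
  (List.nodup_append.1 h.nodup).2.2 v hv v (List.mem_singleton_self v) rfl

theorem not_edge (h : M.IsAncestralOrder (L ++ [v])) (hu : u ∈ L) : ¬ M.edge v u :=
  (List.pairwise_append.1 h.sorted).2.2 u hu v (List.mem_singleton_self v)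

theorem mem_of_edge (h : M.IsAncestralOrder (L ++ [v])) (hu : M.edge u v) : u ∈ L := by
  rcases List.mem_append.1 (h.closed v (by simp) u hu) with huL | huv
  · exact huL
  · exact absurd (List.mem_singleton.1 huv ▸ hu) (edge_irrefl v)

theorem of_append (h : M.IsAncestralOrder (L ++ [v])) : M.IsAncestralOrder L where
  nodup := (List.nodup_append.1 h.nodup).1
  sorted := (List.pairwise_append.1 h.sorted).1
  closed w hw u hu := by
    rcases List.mem_append.1 (h.closed w (List.mem_append_left _ hw) u hu) with huL | huv
    · exact huL
    · exact absurd (List.mem_singleton.1 huv ▸ hu) (h.not_edge hw)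

theorem not_reflTransGen (h : M.IsAncestralOrder (L ++ [v])) (hu : u ∈ L) :
    ¬ Relation.ReflTransGen M.edge v u := fun hvu => by
  induction hvu with
  | refl => exact h.notMem hu
  | tail _ hwu ih => exact ih (h.of_append.closed _ hu _ hwu)

end IsAncestralOrder

end Order

section Sampling

variable {V : Type*} (M : MTBN V)

/-- Assignments of values to the vertices in `E`. -/
abbrev ObsVal (E : Finset V) : Type _ := ∀ u : E, M.X u

/-- The conditional law of `X_v` as a kernel from the joint space. -/
noncomputable def condKernel (v : V) : Kernel M.Joint (M.X v) :=
  (M.K v).comap (M.pa v) (M.measurable_pa v)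

instance (v : V) : IsMarkovKernel (M.condKernel v) := by
  unfold condKernel
  infer_instance

variable [DecidableEq V]

/-- The step that draws a new value of `X_v` given the current values of its parents. -/
noncomputable def resample (v : V) : Kernel M.Joint M.Joint :=
  (Kernel.id ×ₖ M.condKernel v).map (fun q : M.Joint × M.X v => Function.update q.1 v q.2)

instance (v : V) : IsMarkovKernel (M.resample v) :=
  Kernel.IsMarkovKernel.map _ measurable_update'

/-- The law of the variables in `L`, drawn in this order from their conditional laws; the others
keep their values in `x₀`. -/
noncomputable def forwardLaw (L : List V) (x₀ : M.Joint) : Measure M.Joint :=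
  L.foldl (fun ν v => M.resample v ∘ₘ ν) (Measure.dirac x₀)

variable {M} {L : List V} {v : V} {E : Finset V} {e : M.ObsVal E} {x₀ : M.Joint}

theorem pa_update {w : V} (h : ¬ M.edge v w) (x : M.Joint) (y : M.X v) :
    M.pa w (Function.update x v y) = M.pa w x :=
  funext fun u => Function.update_of_ne (fun hu : u.1 = v => h (hu ▸ u.2)) _ _

theorem lintegral_resample {H : M.Joint → ℝ≥0∞} (hH : Measurable H) (x : M.Joint) :
    ∫⁻ z, H z ∂(M.resample v x) = ∫⁻ y, H (Function.update x v y) ∂(M.condKernel v x) := by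
  rw [resample, Kernel.map_apply _ measurable_update', lintegral_map hH measurable_update',
    Kernel.lintegral_id_prod
      (f := fun q : M.Joint × M.X v => H (Function.update q.1 v q.2)) (hH.comp measurable_update')]

theorem ae_resample {p : M.Joint → Prop} (hp : MeasurableSet {z | p z}) {x : M.Joint}
    (h : ∀ y, p (Function.update x v y)) : ∀ᵐ z ∂(M.resample v x), p z := by
  have hind : Measurable ({z | p z}ᶜ.indicator (1 : M.Joint → ℝ≥0∞)) :=
    measurable_one.indicator hp.compl
  refine (lintegral_indicator_one hp.compl).symm.trans ?_
  rw [lintegral_resample hind]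
  simp [h]

theorem forwardLaw_append :
    M.forwardLaw (L ++ [v]) x₀ = M.resample v ∘ₘ M.forwardLaw L x₀ := by
  simp [forwardLaw]

theorem visit_of_mem (hv : v ∈ E) :
    M.visit E e v = Kernel.deterministic (fun x : M.Joint => Function.update x v (e ⟨v, hv⟩))
      (measurable_update'.comp (measurable_id.prodMk measurable_const)) :=
  dif_pos hv

theorem visit_of_notMem (hv : v ∉ E) : M.visit E e v = M.resample v := dif_neg hv

theorem sampleLaw_append :
    M.sampleLaw (L ++ [v]) E e x₀ = M.visit E e v ∘ₘ M.sampleLaw L E e x₀ := by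
  simp [sampleLaw]

theorem sampleLaw_append_of_notMem (hv : v ∉ E) :
    M.sampleLaw (L ++ [v]) E e x₀ = M.resample v ∘ₘ M.sampleLaw L E e x₀ := by
  rw [sampleLaw_append, visit_of_notMem hv]

theorem sampleLaw_append_of_mem (hv : v ∈ E) :
    M.sampleLaw (L ++ [v]) E e x₀ =
      (M.sampleLaw L E e x₀).map (fun x => Function.update x v (e ⟨v, hv⟩)) := by
  rw [sampleLaw_append, visit_of_mem hv, Measure.deterministic_comp_eq_map]

theorem ae_sampleLaw_append_of_notMem (hv : v ∉ E) {p : M.Joint → Prop}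
    (hp : MeasurableSet {x | p x})
    (h : ∀ᵐ x ∂(M.sampleLaw L E e x₀), ∀ y, p (Function.update x v y)) :
    ∀ᵐ x ∂(M.sampleLaw (L ++ [v]) E e x₀), p x := by
  rw [sampleLaw_append_of_notMem hv]
  exact Measure.ae_comp_of_ae_ae hp (h.mono fun _ => ae_resample hp)

theorem measurable_update_const (v : V) (y : M.X v) :
    Measurable fun x : M.Joint => Function.update x v y :=
  measurable_update'.comp (measurable_id.prodMk measurable_const)

theorem ae_sampleLaw_append_of_mem (hv : v ∈ E) {p : M.Joint → Prop}
    (hp : MeasurableSet {x | p x}) :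
    (∀ᵐ x ∂(M.sampleLaw (L ++ [v]) E e x₀), p x) ↔
      ∀ᵐ x ∂(M.sampleLaw L E e x₀), p (Function.update x v (e ⟨v, hv⟩)) := by
  rw [sampleLaw_append_of_mem hv]
  exact ae_map_iff (measurable_update_const v (e ⟨v, hv⟩)).aemeasurable hp

theorem sampleLaw_update (hvL : v ∉ L) (hv : v ∈ E) (e : M.ObsVal E) (x₀ : M.Joint) (y : M.X v) :
    M.sampleLaw L E (Function.update e ⟨v, hv⟩ y) x₀ = M.sampleLaw L E e x₀ := by
  induction L using List.reverseRecOn with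
  | nil => simp only [sampleLaw, List.foldl_nil]
  | append_singleton L w ih =>
    simp only [List.mem_append, List.mem_singleton, not_or] at hvL
    have hvisit : M.visit E (Function.update e ⟨v, hv⟩ y) w = M.visit E e w := by
      by_cases hw : w ∈ E
      · have hne : (⟨w, hw⟩ : E) ≠ ⟨v, hv⟩ := fun h => hvL.2 (congrArg Subtype.val h).symm
        simp only [visit_of_mem hw, Function.update_of_ne hne]
      · rw [visit_of_notMem hw, visit_of_notMem hw]
    rw [sampleLaw_append, sampleLaw_append, ih hvL.1, hvisit]

theorem measurable_sampleLaw (L : List V) (E : Finset V) (x₀ : M.Joint) :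
    Measurable fun e => M.sampleLaw L E e x₀ := by
  induction L using List.reverseRecOn with
  | nil => exact measurable_const
  | append_singleton L v ih =>
    by_cases hv : v ∈ E
    · let κ : Kernel (M.ObsVal E) M.Joint := ⟨_, ih⟩
      have : IsMarkovKernel κ := ⟨fun e =>
        inferInstanceAs (IsProbabilityMeasure (M.sampleLaw L E e x₀))⟩
      refine Measure.measurable_of_measurable_coe _ fun s hs => ?_
      simp_rw [sampleLaw_append_of_mem hv, Measure.map_apply (measurable_update_const v _) hs]
      have hupd : Measurable fun q : M.ObsVal E × M.Joint =>
          Function.update q.2 v (q.1 ⟨v, hv⟩) :=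
        (measurable_update' (a := v)).comp (by fun_prop : Measurable fun q : M.ObsVal E × M.Joint =>
          (q.2, q.1 ⟨v, hv⟩))
      exact Kernel.measurable_kernel_prodMk_left (κ := κ) (hupd hs)
    · simp_rw [sampleLaw_append_of_notMem hv]
      exact (Measure.measurable_bind' (Kernel.measurable _)).comp ih

variable (M) in
/-- The law of one sample as a kernel of the observed values. -/
noncomputable def sampleKernel (L : List V) (E : Finset V) (x₀ : M.Joint) :
    Kernel (M.ObsVal E) M.Joint :=
  ⟨fun e => M.sampleLaw L E e x₀, measurable_sampleLaw L E x₀⟩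

theorem sampleKernel_apply (L : List V) (x₀ : M.Joint) (e : M.ObsVal E) :
    M.sampleKernel L E x₀ e = M.sampleLaw L E e x₀ := rfl

instance (L : List V) (E : Finset V) (x₀ : M.Joint) : IsMarkovKernel (M.sampleKernel L E x₀) :=
  ⟨fun e => inferInstanceAs (IsProbabilityMeasure (M.sampleLaw L E e x₀))⟩

end Sampling

section Represents

variable {V : Type*} {M : MTBN V} {μ : Measure M.Joint} {L : List V} {v : V}

theorem measurable_nd (v : V) : Measurable (M.nd v) :=
  measurable_pi_lambda _ fun _ => measurable_pi_apply _

theorem Represents.measure_inter (hμ : M.Represents μ) (v : V)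
    {A : Set (M.X v)} (hA : MeasurableSet A)
    {B : Set (∀ u : {u // ¬ Relation.ReflTransGen M.edge v u}, M.X u)} (hB : MeasurableSet B) :
    μ ((fun x => x v) ⁻¹' A ∩ M.nd v ⁻¹' B) = ∫⁻ x in M.nd v ⁻¹' B, M.condKernel v x A ∂μ := by
  have := hμ.prob
  have hreal : μ.real ((fun x => x v) ⁻¹' A ∩ M.nd v ⁻¹' B) =
      ∫ x in M.nd v ⁻¹' B, (M.condKernel v x).real A ∂μ := by
    rw [measureReal_inter_eq_setIntegral_condExp (M.measurable_pa v).comap_le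
      (measurable_pi_apply v hA) (measurable_nd v hB) (hμ.condIndep v A hA B hB)]
    exact integral_congr_ae (ae_restrict_of_ae (hμ.condDistrib v A hA).symm)
  have hfin : ∫⁻ x in M.nd v ⁻¹' B, M.condKernel v x A ∂μ ≠ ∞ :=
    ((lintegral_mono fun _ => prob_le_one).trans_lt (by simp)).ne
  rw [← ENNReal.toReal_eq_toReal_iff' (measure_ne_top _ _) hfin,
    ← integral_toReal (Kernel.measurable_coe _ hA).aemeasurable
      (ae_of_all _ fun x => measure_lt_top _ _)]
  exact hreal

theorem Represents.map_nd_prodMk (hμ : M.Represents μ) (v : V) :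
    μ.map (fun x => (M.nd v x, x v)) =
      (Kernel.deterministic (M.nd v) (measurable_nd v) ×ₖ M.condKernel v) ∘ₘ μ := by
  have := hμ.prob
  have hmeas : Measurable fun x : M.Joint => (M.nd v x, x v) :=
    (measurable_nd v).prodMk (measurable_pi_apply v)
  have := Measure.isProbabilityMeasure_map (μ := μ) hmeas.aemeasurable
  refine Measure.ext_prod fun {B A} hB hA => ?_
  rw [Measure.map_apply hmeas (hB.prod hA), Measure.bind_apply (hB.prod hA) (Kernel.aemeasurable _),
    Set.mk_preimage_prod, Set.inter_comm]
  refine (hμ.measure_inter v hA hB).trans ?_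
  rw [← lintegral_indicator (measurable_nd v hB)]
  refine lintegral_congr fun x => ?_
  rw [Kernel.prod_apply, Measure.prod_prod, Kernel.deterministic_apply' _ _ hB]
  by_cases hx : M.nd v x ∈ B <;> simp [hx]

theorem Represents.lintegral_nd (hμ : M.Represents μ) (v : V)
    {H : (∀ u : {u // ¬ Relation.ReflTransGen M.edge v u}, M.X u) → M.X v → ℝ≥0∞}
    (hH : Measurable (Function.uncurry H)) :
    ∫⁻ x, H (M.nd v x) (x v) ∂μ = ∫⁻ x, ∫⁻ y, H (M.nd v x) y ∂(M.condKernel v x) ∂μ := by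
  have hmeas : Measurable fun x : M.Joint => (M.nd v x, x v) :=
    (measurable_nd v).prodMk (measurable_pi_apply v)
  refine (lintegral_map hH hmeas).symm.trans ?_
  rw [hμ.map_nd_prodMk v, Measure.lintegral_bind (Kernel.aemeasurable _) hH.aemeasurable]
  exact lintegral_congr fun x => Kernel.lintegral_deterministic_prod _ _ _ hH

variable [DecidableEq V]

variable (M) in
/-- Keep the coordinates listed in `L` and reset the others to those of `x₀`. -/
def reset (L : List V) (x₀ x : M.Joint) : M.Joint := fun u => if u ∈ L then x u else x₀ u

theorem measurable_reset (L : List V) (x₀ : M.Joint) : Measurable (M.reset L x₀) := by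
  refine measurable_pi_lambda _ fun u => ?_
  by_cases hu : u ∈ L
  · simpa only [reset, if_pos hu] using measurable_pi_apply u
  · simpa only [reset, if_neg hu] using measurable_const

theorem reset_append (L : List V) (v : V) (x₀ x : M.Joint) :
    M.reset (L ++ [v]) x₀ x = Function.update (M.reset L x₀ x) v (x v) := by
  ext u
  by_cases huv : u = v
  · subst huv; simp [reset]
  · simp [reset, huv]

namespace IsAncestralOrder

theorem condKernel_reset (h : M.IsAncestralOrder (L ++ [v])) (x₀ x : M.Joint) :
    M.condKernel v (M.reset L x₀ x) = M.condKernel v x := by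
  have hpa : M.pa v (M.reset L x₀ x) = M.pa v x := funext fun u => if_pos (h.mem_of_edge u.2)
  rw [condKernel, Kernel.comap_apply, Kernel.comap_apply, hpa]

theorem exists_reset_eq_comp_nd (h : M.IsAncestralOrder (L ++ [v])) (x₀ : M.Joint) :
    ∃ r, Measurable r ∧ M.reset L x₀ = r ∘ M.nd v := by
  refine ⟨fun z u => if hu : u ∈ L then z ⟨u, h.not_reflTransGen hu⟩ else x₀ u,
    measurable_pi_lambda _ fun u => ?_, rfl⟩
  by_cases hu : u ∈ L
  · simpa only [dif_pos hu] using measurable_pi_apply _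
  · simpa only [dif_neg hu] using measurable_const

end IsAncestralOrder

theorem Represents.lintegral_update_reset (hμ : M.Represents μ)
    (h : M.IsAncestralOrder (L ++ [v])) (x₀ : M.Joint) {H : M.Joint → ℝ≥0∞} (hH : Measurable H) :
    ∫⁻ x, H (Function.update (M.reset L x₀ x) v (x v)) ∂μ =
      ∫⁻ x, ∫⁻ y, H (Function.update (M.reset L x₀ x) v y) ∂(M.condKernel v x) ∂μ := by
  obtain ⟨r, hr, hreset⟩ := h.exists_reset_eq_comp_nd x₀
  rw [hreset]
  exact hμ.lintegral_nd v (H := fun z y => H (Function.update (r z) v y))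
    (hH.comp (measurable_update'.comp ((hr.comp measurable_fst).prodMk measurable_snd)))

theorem Represents.map_reset (hμ : M.Represents μ) (h : M.IsAncestralOrder L) (x₀ : M.Joint) :
    μ.map (M.reset L x₀) = M.forwardLaw L x₀ := by
  have := hμ.prob
  induction L using List.reverseRecOn with
  | nil =>
    have hconst : M.reset [] x₀ = fun _ => x₀ := by ext; simp [reset]
    rw [hconst, Measure.map_const, measure_univ, one_smul, forwardLaw, List.foldl_nil]
  | append_singleton L v ih =>
    refine Measure.ext_of_lintegral _ fun H hH => ?_
    rw [forwardLaw_append, ← ih h.of_append,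
      Measure.lintegral_bind (Kernel.aemeasurable _) hH.aemeasurable,
      lintegral_map hH.lintegral_kernel (measurable_reset L x₀),
      lintegral_map hH (measurable_reset _ x₀)]
    simp_rw [lintegral_resample hH, reset_append, h.condKernel_reset]
    exact hμ.lintegral_update_reset h x₀ hH

theorem Represents.forwardLaw_eq (hμ : M.Represents μ) (h : M.IsTopologicalOrder L)
    (x₀ : M.Joint) : M.forwardLaw L x₀ = μ := by
  have hid : M.reset L x₀ = id := funext fun x => funext fun u => if_pos (h.complete u)
  rw [← hμ.map_reset h.isAncestralOrder, hid, Measure.map_id]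

end Represents

section Evidence

namespace MixedEvidence

variable {V : Type*} {M : MTBN V} {E : Finset V} (ev : M.MixedEvidence E)

/-- `F_v(z | pa)` as a function of the joint assignment and of the value `z` of `X_v`. -/
noncomputable def massAt (v : E) (x : M.Joint) (z : M.X v) : ℝ≥0 :=
  ev.mass v (M.pa v x) (ev.val v z)

/-- `f_v(z | pa)` as a function of the joint assignment and of the value `z` of `X_v`. -/
noncomputable def densAt (v : E) (x : M.Joint) (z : M.X v) : ℝ≥0 :=
  ev.dens v (M.pa v x) (ev.val v z)

/-- Lebesgue measure on the space of the evidence variable `X_v`. -/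
noncomputable def baseMeasure (v : E) : Measure (M.X v) := volume.map (ev.val v).symm

/-- The values of the evidence variable `X_v` that are atoms of its conditional law for some parent
assignment that agrees with the observations `e`. -/
def atoms (v : E) (e : M.ObsVal E) : Set (M.X v) :=
  {z | ∃ p : M.ParentVal v,
    (∀ (u : {u // M.edge u v}) (hu : u.1 ∈ E), p u = e ⟨u.1, hu⟩) ∧ ev.mass v p (ev.val v z) ≠ 0}

instance (v : E) : SFinite (ev.baseMeasure v) := by
  unfold baseMeasure
  infer_instance

instance (v : E) : NullSingletonClass (ev.baseMeasure v) where
  measure_singleton z := by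
    rw [baseMeasure, MeasurableEquiv.map_apply, ← MeasurableEquiv.image_eq_preimage_symm]
    simp

include ev in
theorem measurableSet_singleton (v : E) (z : M.X v) : MeasurableSet {z} := by
  have : {z} = ev.val v ⁻¹' {ev.val v z} := by ext; simp
  exact this ▸ (ev.val v).measurable (MeasurableSet.singleton _)

theorem coe_mass (v : E) (p : M.ParentVal v) (y : ℝ) :
    (ev.mass v p y : ℝ≥0∞) = M.K v p (ev.val v ⁻¹' {y}) := by
  rw [ev.mixture v p _ (MeasurableSet.singleton y)]
  simp

theorem measurable_mass (v : E) : Measurable (Function.uncurry (ev.mass v)) := by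
  have hs : MeasurableSet {q : (M.ParentVal v × ℝ) × M.X v | ev.val v q.2 = q.1.2} :=
    measurableSet_eq_fun (by fun_prop) (by fun_prop)
  have hK : Measurable fun q : M.ParentVal v × ℝ => M.K v q.1 (ev.val v ⁻¹' {q.2}) :=
    Kernel.measurable_kernel_prodMk_left (κ := (M.K v).comap Prod.fst measurable_fst) hs
  simpa only [← coe_mass, ENNReal.toNNReal_coe, Function.uncurry_def] using hK.ennreal_toNNReal

theorem condKernel_eq (v : E) (x : M.Joint) :
    M.condKernel v x = Measure.sum (fun z => (ev.massAt v x z : ℝ≥0∞) • Measure.dirac z) +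
      (ev.baseMeasure v).withDensity fun z => ev.densAt v x z := by
  ext B hB
  have hB' : MeasurableSet ((ev.val v).symm ⁻¹' B) := (ev.val v).symm.measurable hB
  have hpre : ev.val v ⁻¹' ((ev.val v).symm ⁻¹' B) = B := by
    rw [← Set.preimage_comp, MeasurableEquiv.symm_comp_self, Set.preimage_id]
  have hK := ev.mixture v (M.pa v x) _ hB'
  rw [hpre] at hK
  refine hK.trans ?_
  rw [Measure.add_apply, Measure.sum_apply _ hB, withDensity_apply _ hB, baseMeasure,
    MeasurableEquiv.restrict_map, lintegral_map_equiv]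
  simp only [Measure.smul_apply, Measure.dirac_apply' _ hB, smul_eq_mul, densAt,
    MeasurableEquiv.apply_symm_apply]
  congr 1
  rw [tsum_subtype _ fun y => (ev.mass v (M.pa v x) y : ℝ≥0∞),
    ← (ev.val v).toEquiv.tsum_eq]
  refine tsum_congr fun z => ?_
  by_cases hz : z ∈ B <;> simp [hz, massAt]

theorem isMixture (v : E) :
    IsMixture (M.condKernel v) (ev.baseMeasure v) (ev.massAt v) (ev.densAt v) where
  measurable_mass := (ev.measurable_mass v).comp
    (((M.measurable_pa v).comp measurable_fst).prodMk ((ev.val v).measurable.comp measurable_snd))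
  measurable_dens := (ev.measurable_dens v).comp
    (((M.measurable_pa v).comp measurable_fst).prodMk ((ev.val v).measurable.comp measurable_snd))
  apply_eq := ev.condKernel_eq v

variable [DecidableEq V] {L : List V} {v : V} {e : M.ObsVal E} {x₀ : M.Joint}

include ev in
theorem ae_sampleLaw_eq (e : M.ObsVal E) (x₀ : M.Joint) (u : E) (hu : u.1 ∈ L) :
    ∀ᵐ x ∂(M.sampleLaw L E e x₀), x u = e u := by
  have hm : MeasurableSet {x : M.Joint | x u = e u} :=
    measurable_pi_apply u.1 (ev.measurableSet_singleton u (e u))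
  induction L using List.reverseRecOn with
  | nil => simp at hu
  | append_singleton L v ih =>
    by_cases huv : u.1 = v
    · subst huv
      rw [ae_sampleLaw_append_of_mem u.2 hm]
      exact ae_of_all _ fun x => Function.update_self ..
    · have huL : u.1 ∈ L := by simpa [huv] using hu
      by_cases hv : v ∈ E
      · rw [ae_sampleLaw_append_of_mem hv hm]
        filter_upwards [ih huL] with x hx
        rwa [Function.update_of_ne huv]
      · refine ae_sampleLaw_append_of_notMem hv hm ?_
        filter_upwards [ih huL] with x hx y
        rwa [Function.update_of_ne huv]

include ev in
theorem ae_sampleLaw_obs_eq (hL : ∀ v, v ∈ L) (e : M.ObsVal E) (x₀ : M.Joint) :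
    ∀ᵐ x ∂(M.sampleLaw L E e x₀), M.obs E x = e := by
  filter_upwards [ae_all_iff.2 fun u : E => ev.ae_sampleLaw_eq e x₀ u (hL u)] with x hx
  exact funext hx

theorem ae_massAt_eq_zero_of_notMem_atoms (v : E) (hL : ∀ u, M.edge u v → u ∈ L) (e : M.ObsVal E)
    (x₀ : M.Joint) :
    ∀ᵐ x ∂(M.sampleLaw L E e x₀), ∀ z ∉ ev.atoms v e, ev.massAt v x z = 0 := by
  have hobs : ∀ᵐ x ∂(M.sampleLaw L E e x₀), ∀ u : E, M.edge u v → x u = e u := by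
    refine ae_all_iff.2 fun u => ?_
    by_cases hu : M.edge u v
    · filter_upwards [ev.ae_sampleLaw_eq e x₀ u (hL u hu)] with x hx _ using hx
    · exact ae_of_all _ fun x h => absurd h hu
  filter_upwards [hobs] with x hx z hz
  by_contra hmass
  exact hz ⟨M.pa v x, fun u hu => hx ⟨u.1, hu⟩ u.2, hmass⟩

theorem score_append_of_mem (hv : v ∈ E) (x : M.Joint) :
    ev.score (L ++ [v]) x = lexUpdate (ev.score L x) (ev.massAt ⟨v, hv⟩ x (x v))
      (ev.densAt ⟨v, hv⟩ x (x v)) := by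
  simp [score, hv, lexUpdate, massAt, densAt]

theorem score_append_of_notMem (hv : v ∉ E) (x : M.Joint) :
    ev.score (L ++ [v]) x = ev.score L x := by
  simp [score, hv]

theorem measurable_score (L : List V) : Measurable (ev.score L) := by
  induction L using List.reverseRecOn with
  | nil => exact measurable_const
  | append_singleton L v ih =>
    by_cases hv : v ∈ E
    · rw [funext (ev.score_append_of_mem hv)]
      have hx : Measurable fun x : M.Joint => (x, x v) := by fun_prop
      exact measurable_lexUpdate.comp (ih.prodMk
        (((ev.isMixture ⟨v, hv⟩).measurable_mass.comp hx).prodMk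
          ((ev.isMixture ⟨v, hv⟩).measurable_dens.comp hx)))
    · rwa [funext (ev.score_append_of_notMem hv)]

theorem measurable_weightAt_score (n : ℕ) (L : List V) :
    Measurable fun x => weightAt n (ev.score L x) :=
  measurable_weightAt.comp (measurable_const.prodMk (ev.measurable_score L))

theorem measurableSet_le_score (n : ℕ) (L : List V) : MeasurableSet {x | n ≤ (ev.score L x).1} :=
  measurableSet_le measurable_const (ev.measurable_score L).fst

theorem massAt_update (u : E) (hu : ¬ M.edge v u) (x : M.Joint) (y : M.X v) :
    ev.massAt u (Function.update x v y) = ev.massAt u x := by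
  ext z
  rw [massAt, pa_update hu, massAt]

theorem densAt_update (u : E) (hu : ¬ M.edge v u) (x : M.Joint) (y : M.X v) :
    ev.densAt u (Function.update x v y) = ev.densAt u x := by
  ext z
  rw [densAt, pa_update hu, densAt]

theorem score_update (hv : v ∉ L) (hedge : ∀ w ∈ L, ¬ M.edge v w) (x : M.Joint) (y : M.X v) :
    ev.score L (Function.update x v y) = ev.score L x := by
  induction L using List.reverseRecOn with
  | nil => rfl
  | append_singleton L w ih =>
    simp only [List.mem_append, List.mem_singleton, not_or] at hv hedge
    have hscore := ih hv.1 fun u hu => hedge u (.inl hu)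
    by_cases hw : w ∈ E
    · have hvw := hedge w (.inr rfl)
      rw [score_append_of_mem ev hw, score_append_of_mem ev hw, hscore,
        ev.massAt_update ⟨w, hw⟩ hvw, ev.densAt_update ⟨w, hw⟩ hvw,
        Function.update_of_ne (Ne.symm hv.2)]
    · rw [score_append_of_notMem ev hw, score_append_of_notMem ev hw, hscore]

theorem score_append_update_of_mem (hL : M.IsAncestralOrder (L ++ [v])) (hv : v ∈ E)
    (x : M.Joint) (y : M.X v) :
    ev.score (L ++ [v]) (Function.update x v y) =
      lexUpdate (ev.score L x) (ev.massAt ⟨v, hv⟩ x y) (ev.densAt ⟨v, hv⟩ x y) := by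
  rw [score_append_of_mem ev hv, ev.score_update hL.notMem fun _ => hL.not_edge,
    ev.massAt_update ⟨v, hv⟩ (edge_irrefl v), ev.densAt_update ⟨v, hv⟩ (edge_irrefl v),
    Function.update_self]

theorem score_append_update_of_notMem (hL : M.IsAncestralOrder (L ++ [v])) (hv : v ∉ E)
    (x : M.Joint) (y : M.X v) : ev.score (L ++ [v]) (Function.update x v y) = ev.score L x := by
  rw [score_append_of_notMem ev hv, ev.score_update hL.notMem fun _ => hL.not_edge]

end MixedEvidence

end Evidence

section Disintegration

namespace MixedEvidence

variable {V : Type*} [DecidableEq V] {M : MTBN V} {E : Finset V} (ev : M.MixedEvidence E)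
  {L : List V} {v : V} {x₀ : M.Joint} {ρ : Measure (M.ObsVal E)} {N : M.ObsVal E → ℕ}

/-- The law of one sample, weighted by its likelihood weight if its number of densities is `N e`,
as a kernel of the observations `e`. -/
noncomputable def weightedKernel (L : List V) (x₀ : M.Joint) (N : M.ObsVal E → ℕ) :
    Kernel (M.ObsVal E) M.Joint :=
  (M.sampleKernel L E x₀).withDensity fun e x => weightAt (N e) (ev.score L x)

theorem measurable_uncurry_weightAt_score (L : List V) (hN : Measurable N) :
    Measurable (Function.uncurry fun e x => (weightAt (N e) (ev.score L x) : ℝ≥0∞)) :=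
  (measurable_weightAt.comp ((hN.comp measurable_fst).prodMk
    ((ev.measurable_score L).comp measurable_snd))).coe_nnreal_ennreal

theorem weightedKernel_apply (hN : Measurable N) (e : M.ObsVal E) :
    ev.weightedKernel L x₀ N e =
      (M.sampleLaw L E e x₀).withDensity fun x => weightAt (N e) (ev.score L x) := by
  rw [weightedKernel, Kernel.withDensity_apply _ (ev.measurable_uncurry_weightAt_score L hN),
    sampleKernel_apply]

theorem lintegral_weightedKernel (hN : Measurable N) (e : M.ObsVal E) {H : M.Joint → ℝ≥0∞}
    (hH : Measurable H) :
    ∫⁻ x, H x ∂(ev.weightedKernel L x₀ N e) =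
      ∫⁻ x, weightAt (N e) (ev.score L x) * H x ∂(M.sampleLaw L E e x₀) := by
  rw [weightedKernel_apply ev hN, lintegral_withDensity_eq_lintegral_mul _
    (ev.measurable_weightAt_score (N e) L).coe_nnreal_ennreal hH]
  rfl

/-- The weighted samples disintegrate the law of the network along the observations, whose
distribution up to normalization is `ρ`; `N e` is the least possible number of densities. -/
structure IsDisintegration (L : List V) (x₀ : M.Joint) (ρ : Measure (M.ObsVal E))
    (N : M.ObsVal E → ℕ) : Prop where
  measurable : Measurable N
  update : ∀ v (hv : v ∈ E), v ∉ L → ∀ e y, N (Function.update e ⟨v, hv⟩ y) = N e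
  le_score : ∀ e, ∀ᵐ x ∂(M.sampleLaw L E e x₀), N e ≤ (ev.score L x).1
  comp_eq : ev.weightedKernel L x₀ N ∘ₘ ρ = M.forwardLaw L x₀

variable {ev}

theorem lintegral_resample_comp_weightedKernel (hN : Measurable N) (e : M.ObsVal E)
    {H : M.Joint → ℝ≥0∞} (hH : Measurable H) :
    ∫⁻ x, H x ∂((M.resample v ∘ₖ ev.weightedKernel L x₀ N) e) =
      ∫⁻ x, ∫⁻ y, weightAt (N e) (ev.score L x) * H (Function.update x v y)
        ∂(M.condKernel v x) ∂(M.sampleLaw L E e x₀) := by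
  rw [Kernel.lintegral_comp _ _ _ hH, lintegral_weightedKernel ev hN e hH.lintegral_kernel]
  refine lintegral_congr fun x => ?_
  rw [lintegral_resample hH]
  exact (lintegral_const_mul _ (hH.comp (measurable_update x))).symm

theorem weightedKernel_append_of_notMem (hL : M.IsAncestralOrder (L ++ [v])) (hv : v ∉ E)
    (hN : Measurable N) :
    ev.weightedKernel (L ++ [v]) x₀ N = M.resample v ∘ₖ ev.weightedKernel L x₀ N := by
  refine Kernel.ext_fun fun e H hH => ?_
  have hwH : Measurable fun x => weightAt (N e) (ev.score (L ++ [v]) x) * H x :=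
    (ev.measurable_weightAt_score _ _).coe_nnreal_ennreal.mul hH
  rw [lintegral_weightedKernel ev hN e hH, lintegral_resample_comp_weightedKernel hN e hH,
    sampleLaw_append_of_notMem hv,
    Measure.lintegral_bind (Kernel.aemeasurable _) hwH.aemeasurable]
  simp_rw [lintegral_resample hwH, ev.score_append_update_of_notMem hL hv]

theorem IsDisintegration.append_of_notMem (h : ev.IsDisintegration L x₀ ρ N)
    (hL : M.IsAncestralOrder (L ++ [v])) (hv : v ∉ E) :
    ev.IsDisintegration (L ++ [v]) x₀ ρ N where
  measurable := h.measurable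
  update u hu huL := h.update u hu fun h => huL (List.mem_append_left _ h)
  le_score e := by
    refine ae_sampleLaw_append_of_notMem hv (ev.measurableSet_le_score _ _) ?_
    filter_upwards [h.le_score e] with x hx y
    rwa [ev.score_append_update_of_notMem hL hv]
  comp_eq := by
    rw [weightedKernel_append_of_notMem hL hv h.measurable, ← Measure.comp_assoc, h.comp_eq,
      forwardLaw_append]

variable (ev)

open Classical in
/-- The least number of densities after the observation of `v`, if it is `N` before. -/
noncomputable def leastStep (L : List V) (x₀ : M.Joint) (v : E) (N : M.ObsVal E → ℕ)
    (e : M.ObsVal E) : ℕ :=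
  if meanMass (M.sampleLaw L E e x₀) (ev.massAt v) (e v) = 0 then N e + 1 else N e

/-- The kernel that draws the observation of `v` from its reference measure given the earlier
ones. -/
noncomputable def observe (L : List V) (x₀ : M.Joint) (v : E) :
    Kernel (M.ObsVal E) (M.ObsVal E) :=
  (Kernel.id ×ₖ refKernel (M.sampleKernel L E x₀) (M.condKernel v) (ev.baseMeasure v)
    (ev.massAt v)).map fun q : M.ObsVal E × M.X v => Function.update q.1 v q.2

theorem measurable_leastStep (L : List V) (x₀ : M.Joint) (v : E) (hN : Measurable N) :
    Measurable (ev.leastStep L x₀ v N) := by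
  classical
  have hval : Measurable fun e : M.ObsVal E => (e, e v) := by fun_prop
  exact Measurable.ite (hval ((ev.isMixture v).measurableSet_meanMass_eq_zero
    (κ := M.sampleKernel L E x₀))) (hN.add_const 1) hN

theorem measurable_update_obsVal (v : E) :
    Measurable fun q : M.ObsVal E × M.X v => Function.update q.1 v q.2 :=
  measurable_update'

theorem lintegral_observe (v : E) (e : M.ObsVal E) {Φ : M.ObsVal E → ℝ≥0∞} (hΦ : Measurable Φ) :
    ∫⁻ e', Φ e' ∂(ev.observe L x₀ v e) = ∫⁻ y, Φ (Function.update e v y)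
      ∂(refKernel (M.sampleKernel L E x₀) (M.condKernel v) (ev.baseMeasure v) (ev.massAt v) e) := by
  have hupd := measurable_update_obsVal (M := M) v
  rw [observe, Kernel.map_apply _ hupd, lintegral_map hΦ hupd, Kernel.lintegral_id_prod
    (f := fun q : M.ObsVal E × M.X v => Φ (Function.update q.1 v q.2)) (hΦ.comp hupd)]

variable {ev}

theorem ae_massAt_eq_zero_of_meanMass (v : E) (e : M.ObsVal E) (y : M.X v) :
    ∀ᵐ x ∂(M.sampleLaw L E e x₀),
      meanMass (M.sampleLaw L E e x₀) (ev.massAt v) y = 0 → ev.massAt v x y = 0 := by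
  by_cases hy : meanMass (M.sampleLaw L E e x₀) (ev.massAt v) y = 0
  · filter_upwards [(ev.isMixture v).ae_mass_eq_zero hy] with x hx _ using hx
  · exact ae_of_all _ fun x h => absurd h hy

theorem leastStep_update (hv : v ∈ E) (hvL : v ∉ L) (e : M.ObsVal E) (y : M.X v)
    (hN : N (Function.update e ⟨v, hv⟩ y) = N e) [Decidable
      (meanMass (M.sampleLaw L E e x₀) (ev.massAt ⟨v, hv⟩) y = 0)] :
    ev.leastStep L x₀ ⟨v, hv⟩ N (Function.update e ⟨v, hv⟩ y) =
      if meanMass (M.sampleLaw L E e x₀) (ev.massAt ⟨v, hv⟩) y = 0 then N e + 1 else N e := by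
  rw [leastStep, sampleLaw_update hvL hv, hN, Function.update_self]
  congr

theorem IsDisintegration.lintegral_weightedKernel_append_update
    (h : ev.IsDisintegration L x₀ ρ N) (hL : M.IsAncestralOrder (L ++ [v])) (hv : v ∈ E)
    {H : M.Joint → ℝ≥0∞} (hH : Measurable H) (e : M.ObsVal E) (y : M.X v) :
    ∫⁻ x, H x ∂(ev.weightedKernel (L ++ [v]) x₀ (ev.leastStep L x₀ ⟨v, hv⟩ N)
        (Function.update e ⟨v, hv⟩ y)) =
      ∫⁻ x, mixedLikelihood (M.sampleLaw L E e x₀) (ev.massAt ⟨v, hv⟩) (ev.densAt ⟨v, hv⟩) x y *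
        (weightAt (N e) (ev.score L x) * H (Function.update x v y)) ∂(M.sampleLaw L E e x₀) := by
  classical
  have hwH : Measurable fun x => weightAt (ev.leastStep L x₀ ⟨v, hv⟩ N
      (Function.update e ⟨v, hv⟩ y)) (ev.score (L ++ [v]) x) * H x :=
    (ev.measurable_weightAt_score _ _).coe_nnreal_ennreal.mul hH
  rw [lintegral_weightedKernel ev (ev.measurable_leastStep L x₀ _ h.measurable) _ hH,
    sampleLaw_append_of_mem hv, sampleLaw_update hL.notMem hv,
    lintegral_map hwH (measurable_update_const _ _), Function.update_self,
    leastStep_update hv hL.notMem e y (h.update v hv hL.notMem e y)]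
  refine lintegral_congr_ae ?_
  filter_upwards [h.le_score e, ae_massAt_eq_zero_of_meanMass ⟨v, hv⟩ e y] with x hx hmass
  rw [ev.score_append_update_of_mem hL hv, weightAt_lexUpdate hx hmass, ENNReal.coe_mul, mul_assoc,
    mixedLikelihood]

theorem lintegral_condKernel_eq_refKernel (v : E) (hL : ∀ u, M.edge u v → u ∈ L) (e : M.ObsVal E)
    (hatoms : (ev.atoms v e).Countable) {H : M.Joint → M.X v → ℝ≥0∞}
    (hH : Measurable (Function.uncurry H)) :
    ∫⁻ x, ∫⁻ y, H x y ∂(M.condKernel v x) ∂(M.sampleLaw L E e x₀) =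
      ∫⁻ y, ∫⁻ x, mixedLikelihood (M.sampleLaw L E e x₀) (ev.massAt v) (ev.densAt v) x y * H x y
        ∂(M.sampleLaw L E e x₀) ∂(refKernel (M.sampleKernel L E x₀) (M.condKernel v)
          (ev.baseMeasure v) (ev.massAt v) e) :=
  (ev.isMixture v).lintegral_lintegral_eq_refKernel (κ := M.sampleKernel L E x₀) e hatoms
    (ev.ae_massAt_eq_zero_of_notMem_atoms v hL e x₀) hH

theorem IsDisintegration.weightedKernel_append_comp_observe
    (h : ev.IsDisintegration L x₀ ρ N) (hatoms : ∀ v e, (ev.atoms v e).Countable)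
    (hL : M.IsAncestralOrder (L ++ [v])) (hv : v ∈ E) :
    ev.weightedKernel (L ++ [v]) x₀ (ev.leastStep L x₀ ⟨v, hv⟩ N) ∘ₖ ev.observe L x₀ ⟨v, hv⟩ =
      M.resample v ∘ₖ ev.weightedKernel L x₀ N := by
  refine Kernel.ext_fun fun e H hH => ?_
  have hwH : Measurable (Function.uncurry fun (x : M.Joint) (y : M.X v) =>
      (weightAt (N e) (ev.score L x) : ℝ≥0∞) * H (Function.update x v y)) :=
    ((ev.measurable_weightAt_score (N e) L).coe_nnreal_ennreal.comp measurable_fst).mul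
      (hH.comp measurable_update')
  rw [Kernel.lintegral_comp _ _ _ hH, lintegral_observe ev _ _ hH.lintegral_kernel,
    lintegral_resample_comp_weightedKernel h.measurable e hH]
  simp_rw [h.lintegral_weightedKernel_append_update hL hv hH]
  exact (lintegral_condKernel_eq_refKernel ⟨v, hv⟩ (fun _ => hL.mem_of_edge) e
    (hatoms ⟨v, hv⟩ e) hwH).symm

theorem IsDisintegration.append_of_mem (h : ev.IsDisintegration L x₀ ρ N)
    (hatoms : ∀ v e, (ev.atoms v e).Countable) (hL : M.IsAncestralOrder (L ++ [v])) (hv : v ∈ E) :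
    ev.IsDisintegration (L ++ [v]) x₀ (ev.observe L x₀ ⟨v, hv⟩ ∘ₘ ρ)
      (ev.leastStep L x₀ ⟨v, hv⟩ N) where
  measurable := ev.measurable_leastStep L x₀ _ h.measurable
  update u hu huL e y := by
    simp only [List.mem_append, List.mem_singleton, not_or] at huL
    have hne : (⟨v, hv⟩ : E) ≠ ⟨u, hu⟩ := fun h => huL.2 (congrArg Subtype.val h).symm
    simp only [leastStep, sampleLaw_update huL.1 hu, h.update u hu huL.1,
      Function.update_of_ne hne]
  le_score e := by
    classical
    rw [ae_sampleLaw_append_of_mem hv (ev.measurableSet_le_score _ _)]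
    filter_upwards [h.le_score e, ae_massAt_eq_zero_of_meanMass ⟨v, hv⟩ e (e ⟨v, hv⟩)]
      with x hx hmass
    rw [ev.score_append_update_of_mem hL hv]
    exact le_fst_lexUpdate hx hmass _
  comp_eq := by
    rw [Measure.comp_assoc, h.weightedKernel_append_comp_observe hatoms hL hv,
      ← Measure.comp_assoc, h.comp_eq, forwardLaw_append]

theorem exists_isDisintegration (hatoms : ∀ v e, (ev.atoms v e).Countable)
    (hL : M.IsAncestralOrder L) (x₀ : M.Joint) : ∃ ρ N, ev.IsDisintegration L x₀ ρ N := by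
  induction L using List.reverseRecOn with
  | nil =>
    refine ⟨Measure.dirac (M.obs E x₀), fun _ => 0, measurable_const, fun _ _ _ _ _ => rfl,
      fun e => ae_of_all _ fun x => Nat.zero_le _, ?_⟩
    rw [Measure.dirac_bind (Kernel.measurable _), weightedKernel_apply ev measurable_const]
    simp [sampleLaw, forwardLaw, score, weightAt]
  | append_singleton L v ih =>
    obtain ⟨ρ, N, h⟩ := ih hL.of_append
    by_cases hv : v ∈ E
    · exact ⟨_, _, h.append_of_mem hatoms hL hv⟩
    · exact ⟨_, _, h.append_of_notMem hL hv⟩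

end MixedEvidence

end Disintegration

section Estimator

variable {V : Type*} {M : MTBN V}

variable (M) in
theorem measurable_obs (E : Finset V) : Measurable (M.obs E) :=
  measurable_pi_lambda _ fun _ => measurable_pi_apply _

namespace MixedEvidence

variable [DecidableEq V] {E : Finset V} (ev : M.MixedEvidence E) {L : List V} {x₀ : M.Joint}
  {ρ : Measure (M.ObsVal E)} {N : M.ObsVal E → ℕ}

theorem minDensities_eq {s : ℕ → M.Joint} {d n : ℕ} (hle : ∀ k, d ≤ (ev.score L (s k)).1)
    (hex : ∃ k < n, weightAt d (ev.score L (s k)) ≠ 0) : ev.minDensities L n s = d := by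
  obtain ⟨k, hk, hw⟩ := hex
  obtain ⟨hd, hw⟩ := ite_ne_right_iff.1 hw
  refine IsLeast.csInf_eq ⟨⟨k, hk, hw, hd⟩, ?_⟩
  rintro _ ⟨j, -, -, rfl⟩
  exact hle j

theorem estimate_eq {s : ℕ → M.Joint} {d n : ℕ} (g : M.Joint → ℝ)
    (h : ev.minDensities L n s = d) :
    ev.estimate L g n s =
      (∑ k ∈ Finset.range n, (weightAt d (ev.score L (s k)) : ℝ) * g (s k)) /
        ∑ k ∈ Finset.range n, (weightAt d (ev.score L (s k)) : ℝ) := by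
  simp only [estimate, h, Finset.sum_filter, weightAt, apply_ite NNReal.toReal, NNReal.coe_zero,
    ite_mul, zero_mul]

theorem ae_weightedKernel_obs_eq (hL : ∀ v, v ∈ L) (hN : Measurable N) (e : M.ObsVal E) :
    ∀ᵐ x ∂(ev.weightedKernel L x₀ N e), M.obs E x = e := by
  rw [weightedKernel_apply ev hN]
  exact (withDensity_absolutelyContinuous _ _).ae_le (ev.ae_sampleLaw_obs_eq hL e x₀)

variable {ev}

namespace IsDisintegration

theorem ae_minDensities_eq (h : ev.IsDisintegration L x₀ ρ N) {e : M.ObsVal E}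
    (h0 : ev.weightedKernel L x₀ N e Set.univ ≠ 0) :
    ∀ᵐ s ∂(Measure.infinitePi fun _ : ℕ => M.sampleLaw L E e x₀),
      ∀ᶠ n in atTop, ev.minDensities L n s = N e := by
  have hA : MeasurableSet {x | weightAt (N e) (ev.score L x) ≠ 0} :=
    (ev.measurable_weightAt_score (N e) L (MeasurableSet.singleton 0)).compl
  have hA0 : M.sampleLaw L E e x₀ {x | weightAt (N e) (ev.score L x) ≠ 0} ≠ 0 := by
    refine fun hzero => h0 ?_
    rw [weightedKernel_apply ev h.measurable, withDensity_apply _ .univ, Measure.restrict_univ]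
    exact lintegral_eq_zero_of_ae_eq_zero (ae_iff.2 (by simpa using hzero))
  have hle : ∀ᵐ s ∂(Measure.infinitePi fun _ : ℕ => M.sampleLaw L E e x₀),
      ∀ k, N e ≤ (ev.score L (s k)).1 :=
    ae_all_iff.2 fun k => (measurePreserving_eval_infinitePi
      (fun _ : ℕ => M.sampleLaw L E e x₀) k).quasiMeasurePreserving.ae (h.le_score e)
  filter_upwards [hle, ae_exists_mem_infinitePi hA hA0] with s hs ⟨k, hk⟩
  filter_upwards [eventually_gt_atTop k] with n hn
  exact ev.minDensities_eq hs ⟨k, hn, hk⟩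

theorem ae_tendsto_estimate (h : ev.IsDisintegration L x₀ ρ N) {e : M.ObsVal E}
    (h0 : ev.weightedKernel L x₀ N e Set.univ ≠ 0)
    (htop : ev.weightedKernel L x₀ N e Set.univ ≠ ∞) {g : M.Joint → ℝ} (hg : Measurable g)
    (hgi : Integrable g (ev.weightedKernel L x₀ N e)) :
    ∀ᵐ s ∂(Measure.infinitePi fun _ : ℕ => M.sampleLaw L E e x₀),
      Tendsto (fun n => ev.estimate L g n s) atTop
        (𝓝 (⨍ x, g x ∂(ev.weightedKernel L x₀ N e))) := by
  have hmin := h.ae_minDensities_eq h0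
  rw [weightedKernel_apply ev h.measurable] at h0 htop hgi ⊢
  filter_upwards [hmin, ae_tendsto_selfNormalized_average
    (ev.measurable_weightAt_score (N e) L) htop h0 hg hgi] with s hs hlim
  refine hlim.congr' ?_
  filter_upwards [hs] with n hn using (ev.estimate_eq g hn).symm

end IsDisintegration

end MixedEvidence

end Estimator

end MTBN

theorem theorem2 {V : Type*} [Finite V] [DecidableEq V] (M : MTBN V)
    (μ : Measure M.Joint) (hμ : M.Represents μ)
    (E : Finset V) (ev : M.MixedEvidence E)
    (hcount : ∀ (v : E) (e : ∀ u : E, M.X u),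
      {y : ℝ | ∃ p : M.ParentVal v,
        (∀ (u : {u // M.edge u v}) (hu : u.1 ∈ E), p u = e ⟨u.1, hu⟩) ∧
          ev.mass v p y ≠ 0}.Countable)
    (L : List V) (hL : M.IsTopologicalOrder L) (x₀ : M.Joint)
    (g : M.Joint → ℝ) (hg : Measurable g) (hgi : Integrable g μ) :
    ∀ᵐ x ∂μ, ∀ᵐ s ∂(Measure.infinitePi fun _ : ℕ => M.sampleLaw L E (M.obs E x) x₀),
      Tendsto (fun n => ev.estimate L g n s) atTop
        (𝓝 ((μ[g | MeasurableSpace.comap (M.obs E) inferInstance]) x)) := by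
  have := hμ.prob
  have hatoms : ∀ v e, (ev.atoms v e).Countable :=
    fun v e => (hcount v e).preimage (ev.val v).injective
  obtain ⟨ρ, N, h⟩ := ev.exists_isDisintegration hatoms hL.isAncestralOrder x₀
  obtain rfl : ev.weightedKernel L x₀ N ∘ₘ ρ = μ := h.comp_eq.trans (hμ.forwardLaw_eq hL x₀)
  have hobs : ∀ᵐ e ∂ρ, ∀ᵐ x ∂(ev.weightedKernel L x₀ N e), M.obs E x = e :=
    ae_of_all _ (ev.ae_weightedKernel_obs_eq hL.complete h.measurable)
  have hconv : ∀ᵐ e ∂ρ, ev.weightedKernel L x₀ N e Set.univ ≠ 0 →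
      ∀ᵐ s ∂(Measure.infinitePi fun _ : ℕ => M.sampleLaw L E e x₀),
        Tendsto (fun n => ev.estimate L g n s) atTop
          (𝓝 (⨍ y, g y ∂(ev.weightedKernel L x₀ N e))) := by
    filter_upwards [ae_measure_univ_lt_top (η := ev.weightedKernel L x₀ N),
      Measure.ae_integrable_of_integrable_comp hgi] with e htop hgfibre h0
    exact h.ae_tendsto_estimate h0 htop.ne hg hgfibre
  filter_upwards [condExp_comap_ae_eq_average (M.measurable_obs E) hobs hgi,
    ae_comp_of_ae_of_ne_zero (M.measurable_obs E) hobs hconv] with x hx hlim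
  rwa [hx]
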